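/- Let $(X,Y)$ be a pair of real-valued random variables on a probability space $(\Omega,\mathcal{A},\mathbb{P})$ whose joint distribution is totally positive of order two (TP2), that is, \[ \mathbb{P}(X\in A_2,\,Y\in B_1)\,\mathbb{P}(X\in A_1,\,Y\in B_2)\ \le\ \mathbb{P}(X\in A_1,\,Y\in B_1)\,\mathbb{P}(X\in A_2,\,Y\in B_2) \] for all Borel sets $A_1<A_2$ and $B_1<B_2$ (element-wise). Let $Q$ be the distribution of $Y$, let \[ \mathcal{X}:=\{x\in\mathbb{R}:\ \mathbb{P}(X\le x)>0 \text{ and } \mathbb{P}(X\ge x)>0\} \] be the range of $X$, and for $x\in\mathbb{R}$ put \[ S_{\rm nw}(x):=\min\{y\in[-\infty,\infty]:\ \mathbb{P}(X\le x,\,Y>y)=0\},\qquad S_{\rm se}(x):=\max\{y\in[-\infty,\infty]:\ \mathbb{P}(X\ge x,\,Y<y)=0\}. \] Let $\mathcal{X}_o:=\{x\in\mathcal{X}:\ S_{\rm nw}(x)\le S_{\rm se}(x)\}$. For probability measures $\mu,\nu$ on $\mathbb{R}$ write $\mu\le_{\rm lr}\nu$ (likelihood ratio order) if $\mu(B)\,\nu(A)\le\mu(A)\,\nu(B)$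 for all Borel sets $A\le B$ (element-wise). Then there exist isotonic (i.e. non-decreasing) functions $S:\mathcal{X}_o\to\mathbb{R}$ with $S_{\rm nw}(x)\le S(x)\le S_{\rm se}(x)$ for all $x\in\mathcal{X}_o$; and for every such function $S$ there is a stochastic kernel $K$ from $\mathbb{R}$ to $\mathbb{R}$ which describes the conditional distribution of $Y$ given $X$, i.e. $\mathbb{P}(X\in A,\,Y\in B)=\mathbb{E}\bigl(1_A(X)\,K(X,B)\bigr)$ for all Borel sets $A,B$, such that $K(x_1,\cdot)\le_{\rm lr}K(x_2,\cdot)$ for all $x_1<x_2$ in $\mathcal{X}$, and such that the following hold. (a) If $x\in\mathcal{X}_o$, then $K(x,\cdot)=\delta_{S(x)}$. (b) There is a function $h$ such that for every $x\in\mathcal{X}\setminus\mathcal{X}_o$, $h(x,\cdot)$ is a bounded (measurable, non-negative) density of $K(x,\cdot)$ with respect to $Q$, and $h(x,y)=0$ whenever $y<S_{\rm se}(x)$ or $y>S_{\rm nw}(x)$. Moreover, $h$ is TP2 on $(\mathcal{X}\setminus\mathcal{X}_o)\times\mathbb{R}$, that is, \[ h(x_2,y_1)\,h(x_1,y_2)\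 \le\ h(x_1,y_1)\,h(x_2,y_2) \] for all $x_1<x_2$ in $\mathcal{X}\setminus\mathcal{X}_o$ and all real numbers $y_1<y_2$. -/

import Mathlib

open MeasureTheory ProbabilityTheory
open scoped ENNReal

namespace LikelihoodRatio

/-- Likelihood ratio order `μ ≤_lr ν`: `μ(B) ν(A) ≤ μ(A) ν(B)` for all Borel sets `A ≤ B`
(element-wise). -/
def LRLe (μ ν : Measure ℝ) : Prop :=
  ∀ A B : Set ℝ, MeasurableSet A → MeasurableSet B → (∀ a ∈ A, ∀ b ∈ B, a ≤ b) →
    μ B * ν A ≤ μ A * ν B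

/-- Total positivity of order two of a distribution on `ℝ × ℝ`. -/
def IsTP2Measure (R : Measure (ℝ × ℝ)) : Prop :=
  ∀ A₁ A₂ B₁ B₂ : Set ℝ, MeasurableSet A₁ → MeasurableSet A₂ →
    MeasurableSet B₁ → MeasurableSet B₂ →
    (∀ a₁ ∈ A₁, ∀ a₂ ∈ A₂, a₁ < a₂) → (∀ b₁ ∈ B₁, ∀ b₂ ∈ B₂, b₁ < b₂) →
    R (A₂ ×ˢ B₁) * R (A₁ ×ˢ B₂) ≤ R (A₁ ×ˢ B₁) * R (A₂ ×ˢ B₂)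

/-- Total positivity of order two of a function `h` on `D × ℝ`. -/
def IsTP2On (h : ℝ → ℝ → ℝ) (D : Set ℝ) : Prop :=
  ∀ x₁ ∈ D, ∀ x₂ ∈ D, x₁ < x₂ → ∀ y₁ y₂ : ℝ, y₁ < y₂ →
    h x₂ y₁ * h x₁ y₂ ≤ h x₁ y₁ * h x₂ y₂

section Pair

variable {Ω : Type*} [MeasurableSpace Ω]

/-- The range of `X`: the points `x` with `P(X ≤ x) > 0` and `P(X ≥ x) > 0`. -/
def range (P : Measure Ω) (X : Ω → ℝ) : Set ℝ :=
  {x | 0 < P {ω | X ω ≤ x} ∧ 0 < P {ω | x ≤ X ω}}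

/-- The northwest boundary, the least `y ∈ [-∞, ∞]` with `P(X ≤ x, Y > y) = 0`;
see `isLeast_Snw`. -/
noncomputable def Snw (P : Measure Ω) (X Y : Ω → ℝ) (x : ℝ) : EReal :=
  sInf {y : EReal | P {ω | X ω ≤ x ∧ y < (Y ω : EReal)} = 0}

/-- The southeast boundary, the greatest `y ∈ [-∞, ∞]` with `P(X ≥ x, Y < y) = 0`;
see `isGreatest_Sse`. -/
noncomputable def Sse (P : Measure Ω) (X Y : Ω → ℝ) (x : ℝ) : EReal :=
  sSup {y : EReal | P {ω | x ≤ X ω ∧ (Y ω : EReal) < y} = 0}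

/-- The infimum defining `Snw` is a minimum. -/
theorem isLeast_Snw (P : Measure Ω) (X Y : Ω → ℝ) (x : ℝ) :
    IsLeast {y : EReal | P {ω | X ω ≤ x ∧ y < (Y ω : EReal)} = 0} (Snw P X Y x) := by
  refine ⟨?_, fun y hy => sInf_le hy⟩
  obtain ⟨u, -, hu, huS⟩ := exists_seq_tendsto_sInf
    (S := {y : EReal | P {ω | X ω ≤ x ∧ y < (Y ω : EReal)} = 0})
    ⟨⊤, by simp⟩ (OrderBot.bddBelow _)
  refine measure_mono_null (t := ⋃ n, {ω | X ω ≤ x ∧ u n < (Y ω : EReal)}) ?_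
    (measure_iUnion_null huS)
  rintro ω ⟨h₁, h₂⟩
  obtain ⟨n, hn⟩ := (hu.eventually_lt_const h₂).exists
  exact Set.mem_iUnion.2 ⟨n, h₁, hn⟩

/-- The supremum defining `Sse` is a maximum. -/
theorem isGreatest_Sse (P : Measure Ω) (X Y : Ω → ℝ) (x : ℝ) :
    IsGreatest {y : EReal | P {ω | x ≤ X ω ∧ (Y ω : EReal) < y} = 0} (Sse P X Y x) := by
  refine ⟨?_, fun y hy => le_sSup hy⟩
  obtain ⟨u, -, hu, huS⟩ := exists_seq_tendsto_sSup
    (S := {y : EReal | P {ω | x ≤ X ω ∧ (Y ω : EReal) < y} = 0})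
    ⟨⊥, by simp⟩ (OrderTop.bddAbove _)
  refine measure_mono_null (t := ⋃ n, {ω | x ≤ X ω ∧ (Y ω : EReal) < u n}) ?_
    (measure_iUnion_null huS)
  rintro ω ⟨h₁, h₂⟩
  obtain ⟨n, hn⟩ := (hu.eventually_const_lt h₂).exists
  exact Set.mem_iUnion.2 ⟨n, h₁, hn⟩

/-- The part of the range of `X` on which `Snw ≤ Sse`. -/
def rangeO (P : Measure Ω) (X Y : Ω → ℝ) : Set ℝ :=
  {x ∈ range P X | Snw P X Y x ≤ Sse P X Y x}

/-- `S` restricts to an isotonic function on `rangeO` lying between the two boundaries; its values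
outside `rangeO` are irrelevant. -/
def IsIsotonicSelection (P : Measure Ω) (X Y : Ω → ℝ) (S : ℝ → ℝ) : Prop :=
  MonotoneOn S (rangeO P X Y) ∧
    ∀ x ∈ rangeO P X Y, Snw P X Y x ≤ (S x : EReal) ∧ (S x : EReal) ≤ Sse P X Y x

end Pair

/-- `g` is a bounded density of `ν` with respect to `Q`. -/
def IsBoundedDensity (g : ℝ → ℝ) (ν Q : Measure ℝ) : Prop :=
  Measurable g ∧ (∀ y, 0 ≤ g y) ∧ (∃ C : ℝ, ∀ y, g y ≤ C) ∧
    ν = Q.withDensity fun y => ENNReal.ofReal (g y)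

end LikelihoodRatio

/-!
At a point `z` of the range with `S_se(z) < S_nw(z)`, truncate the second coordinate to
`[-∞, S_nw(z)]` and condition on the first coordinate lying in `[z, t]`. As `t` decreases to the
first point after `z` charged by `X`, these laws have a setwise limit along an ultrafilter, because
TP2 bounds all of them by a common multiple of `Q`: comparison with the slice to the left of `z`
controls the mass below a level between the two boundaries, comparison with a slice to the right
the mass above it. The limit lies, in the likelihood ratio order, between all slices to the left
and all slices to the right of `z`, and so does the point mass at `S(z)` if `S_nw(z) ≤ S_se(z)`.
By monotonicity, a family with this sandwich property agrees almost everywhere with any conditional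
law, hence disintegrates the joint distribution.

The densities are limits of quotients of the measures of shrinking balls along an ultrafilter. These
exist at every point, inherit the TP2 inequality at every point, and are measurable because the
sandwich writes them through one isotonic and one antitonic function.
-/

open Set Filter Topology

namespace LikelihoodRatio

section Order

variable {α β : Type*}

theorem forall_lt_or_exists_of_forall_le [PartialOrder α] {A B : Set α}
    (h : ∀ a ∈ A, ∀ b ∈ B, a ≤ b) :
    (∀ a ∈ A, ∀ b ∈ B, a < b) ∨
      ∃ c ∈ A ∩ B, (∀ a ∈ A \ {c}, a < c) ∧ ∀ b ∈ B \ {c}, c < b := by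
  rcases (A ∩ B).eq_empty_or_nonempty with hdisj | ⟨c, hc⟩
  · exact .inl fun a ha b hb => (h a ha b hb).lt_of_ne fun hab =>
      notMem_empty a (hdisj ▸ ⟨ha, hab ▸ hb⟩)
  · exact .inr ⟨c, hc, fun a ha => (h a ha.1 c hc.2).lt_of_ne ha.2,
      fun b hb => (h c hc.1 b hb.1).lt_of_ne' hb.2⟩

variable [TopologicalSpace α] [LinearOrder α] [OrderClosedTopology α] [SecondCountableTopology α]
  [MeasurableSpace α] {μ : Measure α}

theorem measure_eq_zero_of_forall_inter_Ici {F : Set α} (h : ∀ x ∈ F, μ (F ∩ Ici x) = 0) :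
    μ F = 0 := by
  refine measure_null_of_locally_null _ fun x hx => ?_
  by_cases hx' : ∃ a ∈ F, a < x
  · obtain ⟨a, ha, hax⟩ := hx'
    exact ⟨_, inter_mem self_mem_nhdsWithin (mem_nhdsWithin_of_mem_nhds (Ici_mem_nhds hax)),
      h a ha⟩
  · push Not at hx'
    exact ⟨_, inter_mem self_mem_nhdsWithin (mem_of_superset self_mem_nhdsWithin hx'), h x hx⟩

theorem measure_eq_zero_of_forall_inter_Iic {F : Set α} (h : ∀ x ∈ F, μ (F ∩ Iic x) = 0) :
    μ F = 0 :=
  measure_eq_zero_of_forall_inter_Ici (α := αᵒᵈ) h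

variable [LinearOrder β] [DenselyOrdered β] [TopologicalSpace β] [OrderTopology β]
  [TopologicalSpace.SeparableSpace β] {g k : α → β}

theorem ae_le_of_ae_forall_ge (h : ∀ᵐ x ∂μ, ∀ᵐ y ∂μ, x ≤ y → g y ≤ k x) : g ≤ᵐ[μ] k := by
  obtain ⟨s, hs, hds⟩ := TopologicalSpace.exists_countable_dense β
  set G : Set α := {x | ∀ᵐ y ∂μ, x ≤ y → g y ≤ k x}
  have hnull : ∀ q ∈ s, μ {x ∈ G | k x < q ∧ q < g x} = 0 := fun q _ =>
    measure_eq_zero_of_forall_inter_Ici fun x hx =>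
      measure_mono_null (t := {y | ¬(x ≤ y → g y ≤ k x)})
        (fun y hy hxy => (hx.2.1.trans hy.1.2.2).not_ge (hxy hy.2)) (ae_iff.1 hx.1)
  filter_upwards [h, (ae_ball_iff hs).2 fun q hq => measure_eq_zero_iff_ae_notMem.1 (hnull q hq)]
    with x hxG hx
  by_contra! hlt
  obtain ⟨q, hq, hkq, hqg⟩ := hds.exists_between hlt
  exact hx q hq ⟨hxG, hkq, hqg⟩

theorem ae_le_of_ae_forall_le (h : ∀ᵐ x ∂μ, ∀ᵐ y ∂μ, y ≤ x → k x ≤ g y) : k ≤ᵐ[μ] g :=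
  ae_le_of_ae_forall_ge (α := αᵒᵈ) (β := βᵒᵈ) h

end Order

section SetwiseTendsto

variable {α ι : Type*} [MeasurableSpace α]

/-- Setwise convergence of measures: convergence of the values on every measurable set. This is the
mode of convergence under which inequalities between products of measures of sets persist. -/
def SetwiseTendsto (u : ι → Measure α) (l : Filter ι) (κ : Measure α) : Prop :=
  ∀ B, MeasurableSet B → Tendsto (fun i => u i B) l (𝓝 (κ B))

theorem SetwiseTendsto.const (κ : Measure α) (l : Filter ι) : SetwiseTendsto (fun _ => κ) l κ :=
  fun _ _ => tendsto_const_nhds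

theorem SetwiseTendsto.eq_zero {u : ι → Measure α} {l : Filter ι} [l.NeBot] {κ : Measure α}
    (h : SetwiseTendsto u l κ) {B : Set α} (hB : MeasurableSet B) (h0 : ∀ i, u i B = 0) :
    κ B = 0 :=
  tendsto_nhds_unique (h B hB) (by simp only [h0, tendsto_const_nhds])

theorem exists_setwiseTendsto (l : Ultrafilter ι) {u : ι → Measure α} {Q : Measure α}
    [IsFiniteMeasure Q] (h : ∀ᶠ i in l, u i ≤ Q) : ∃ κ ≤ Q, SetwiseTendsto u l κ := by
  let m : Set α → ℝ≥0∞ := fun B => (l.map fun i => u i B).lim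
  have hm : ∀ B, Tendsto (fun i => u i B) l (𝓝 (m B)) := fun B =>
    (l.map fun i => u i B).le_nhds_lim
  have hmQ : ∀ B, m B ≤ Q B := fun B => le_of_tendsto (hm B) (h.mono fun i hi => hi B)
  have hm0 : m ∅ = 0 :=
    tendsto_nhds_unique (hm ∅) (by simp only [measure_empty, tendsto_const_nhds])
  have hring : IsSetRing {B : Set α | MeasurableSet B} :=
    ⟨.empty, fun _ _ => .union, fun _ _ => .diff⟩
  let c : AddContent ℝ≥0∞ {B : Set α | MeasurableSet B} :=
    hring.addContent_of_union m hm0 fun {A B} _ hB hAB => by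
      refine tendsto_nhds_unique (hm _) ?_
      simp only [measure_union hAB hB]
      exact (hm A).add (hm B)
  have hcont : ∀ ⦃s : ℕ → Set α⦄, (∀ n, MeasurableSet (s n)) → Antitone s → ⋂ n, s n = ∅ →
      Tendsto (fun n => c (s n)) atTop (𝓝 0) := fun s hs hanti hempty => by
    refine tendsto_of_tendsto_of_tendsto_of_le_of_le tendsto_const_nhds ?_ (fun _ => bot_le)
      fun n => hmQ (s n)
    simpa only [hempty, measure_empty, Function.comp_def] using tendsto_measure_iInter_atTop
      (fun n => (hs n).nullMeasurableSet) hanti ⟨0, measure_ne_top Q _⟩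
  have hκ := fun (B : Set α) (hB : MeasurableSet B) => Measure.ofMeasurable_apply
    (m := fun B _ => m B) (m0 := hm0) (mU := fun f hf hd =>
      addContent_iUnion_eq_sum_of_tendsto_zero hring c
        (fun B _ => ((hmQ B).trans_lt (measure_lt_top Q B)).ne) hcont hf (.iUnion hf) hd) B hB
  exact ⟨_, Measure.le_iff.2 fun B hB => (hκ B hB).trans_le (hmQ B), fun B hB =>
    (hκ B hB).symm ▸ hm B⟩

end SetwiseTendsto

/-- The likelihood ratio order tested only on strictly separated sets. On measures on `ℝ` it
agrees with `LRLe`, but being free of common points of the two sets it is easier to verify. -/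
def StrictLRLe {α : Type*} [Preorder α] [MeasurableSpace α] (μ ν : Measure α) : Prop :=
  ∀ B₁ B₂ : Set α, MeasurableSet B₁ → MeasurableSet B₂ → (∀ b₁ ∈ B₁, ∀ b₂ ∈ B₂, b₁ < b₂) →
    μ B₂ * ν B₁ ≤ μ B₁ * ν B₂

namespace StrictLRLe

section Preorder

variable {α : Type*} [Preorder α] [MeasurableSpace α] {μ μ₁ μ₂ ν ν₁ ν₂ : Measure α} {L : Set α}

theorem refl (μ : Measure α) : StrictLRLe μ μ := fun _ _ _ _ _ => (mul_comm _ _).le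

theorem add_left (h₁ : StrictLRLe μ₁ ν) (h₂ : StrictLRLe μ₂ ν) : StrictLRLe (μ₁ + μ₂) ν := by
  intro B₁ B₂ m₁ m₂ hB
  simp only [Measure.add_apply, add_mul]
  exact add_le_add (h₁ B₁ B₂ m₁ m₂ hB) (h₂ B₁ B₂ m₁ m₂ hB)

theorem add_right (h₁ : StrictLRLe μ ν₁) (h₂ : StrictLRLe μ ν₂) : StrictLRLe μ (ν₁ + ν₂) := by
  intro B₁ B₂ m₁ m₂ hB
  simp only [Measure.add_apply, mul_add]
  exact add_le_add (h₁ B₁ B₂ m₁ m₂ hB) (h₂ B₁ B₂ m₁ m₂ hB)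

theorem smul_left (c : ℝ≥0∞) (h : StrictLRLe μ ν) : StrictLRLe (c • μ) ν := by
  intro B₁ B₂ m₁ m₂ hB
  simp only [Measure.smul_apply, smul_eq_mul, mul_assoc]
  exact mul_le_mul_right (h B₁ B₂ m₁ m₂ hB) c

theorem smul_right (c : ℝ≥0∞) (h : StrictLRLe μ ν) : StrictLRLe μ (c • ν) := by
  intro B₁ B₂ m₁ m₂ hB
  simp only [Measure.smul_apply, smul_eq_mul, mul_left_comm _ c]
  exact mul_le_mul_right (h B₁ B₂ m₁ m₂ hB) c

theorem restrict_left (h : StrictLRLe μ ν) (hL : IsLowerSet L) (mL : MeasurableSet L) :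
    StrictLRLe (μ.restrict L) ν := by
  intro B₁ B₂ m₁ m₂ hB
  rw [Measure.restrict_apply m₁, Measure.restrict_apply m₂]
  rcases (B₂ ∩ L).eq_empty_or_nonempty with hempty | ⟨b, hb, hbL⟩
  · simp [hempty]
  · rw [inter_eq_left.2 fun a ha => hL (hB a ha b hb).le hbL]
    calc μ (B₂ ∩ L) * ν B₁ ≤ μ B₁ * ν (B₂ ∩ L) :=
          h B₁ (B₂ ∩ L) m₁ (m₂.inter mL) fun a ha b hb => hB a ha b hb.1
      _ ≤ μ B₁ * ν B₂ := by gcongr; exact inter_subset_left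

theorem restrict_right (h : StrictLRLe μ ν) (hμ : μ Lᶜ = 0) (mL : MeasurableSet L) :
    StrictLRLe μ (ν.restrict L) := by
  intro B₁ B₂ m₁ m₂ hB
  rw [Measure.restrict_apply m₁, Measure.restrict_apply m₂, ← measure_inter_conull hμ]
  calc μ (B₂ ∩ L) * ν (B₁ ∩ L) ≤ μ (B₁ ∩ L) * ν (B₂ ∩ L) :=
        h _ _ (m₁.inter mL) (m₂.inter mL) fun a ha b hb => hB a ha.1 b hb.1
    _ ≤ μ B₁ * ν (B₂ ∩ L) := by gcongr; exact inter_subset_left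

theorem cond_left (h : StrictLRLe μ ν) (hL : IsLowerSet L) (mL : MeasurableSet L) :
    StrictLRLe μ[|L] ν :=
  (h.restrict_left hL mL).smul_left _

theorem cond_right (h : StrictLRLe μ ν) (hμ : μ Lᶜ = 0) (mL : MeasurableSet L) :
    StrictLRLe μ ν[|L] :=
  (h.restrict_right hμ mL).smul_right _

theorem of_setwiseTendsto {ι : Type*} {l : Filter ι} [l.NeBot] {u v : ι → Measure α}
    [IsFiniteMeasure μ] [IsFiniteMeasure ν] (hu : SetwiseTendsto u l μ)
    (hv : SetwiseTendsto v l ν) (h : ∀ᶠ i in l, StrictLRLe (u i) (v i)) : StrictLRLe μ ν :=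
  fun B₁ B₂ m₁ m₂ hB => le_of_tendsto_of_tendsto
    (ENNReal.Tendsto.mul (hu B₂ m₂) (.inr (measure_ne_top _ _)) (hv B₁ m₁)
      (.inr (measure_ne_top _ _)))
    (ENNReal.Tendsto.mul (hu B₁ m₁) (.inr (measure_ne_top _ _)) (hv B₂ m₂)
      (.inr (measure_ne_top _ _)))
    (h.mono fun _ hi => hi B₁ B₂ m₁ m₂ hB)

end Preorder

section LinearOrder

variable {α : Type*} [LinearOrder α] [MeasurableSpace α] {μ ν κ Q : Measure α}

theorem of_separated {s : α} (hμ : μ (Ioi s) = 0) (hν : ν (Iio s) = 0) : StrictLRLe μ ν := by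
  intro B₁ B₂ _ _ hB
  by_cases h₂ : B₂ ⊆ Ioi s
  · simp [measure_mono_null h₂ hμ]
  · obtain ⟨b, hb, hbs⟩ := not_subset.1 h₂
    have h₁ : B₁ ⊆ Iio s := fun a ha => (hB a ha b hb).trans_le (not_lt.1 hbs)
    simp [measure_mono_null h₁ hν]

variable [TopologicalSpace α] [OrderClosedTopology α] [OpensMeasurableSpace α]

theorem measure_Iic_mul_le (h : StrictLRLe μ ν) (c : α) :
    ν (Iic c) * μ univ ≤ μ (Iic c) * ν univ := by
  have hsplit : ∀ ρ : Measure α, ρ univ = ρ (Iic c) + ρ (Ioi c) := fun ρ => by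
    rw [← measure_add_measure_compl measurableSet_Iic, compl_Iic]
  have hsep := h (Iic c) (Ioi c) measurableSet_Iic measurableSet_Ioi fun a ha b hb =>
    lt_of_le_of_lt ha hb
  calc ν (Iic c) * μ univ = μ (Iic c) * ν (Iic c) + μ (Ioi c) * ν (Iic c) := by
        rw [hsplit μ]; ring
    _ ≤ μ (Iic c) * ν (Iic c) + μ (Iic c) * ν (Ioi c) := by gcongr
    _ = μ (Iic c) * ν univ := by rw [hsplit ν, mul_add]

theorem measure_Iio_ne_zero (h : StrictLRLe μ ν) (hμ : μ ≠ 0) {y : α} (hν : ν (Iio y) ≠ 0) :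
    μ (Iio y) ≠ 0 := by
  intro h0
  have hsep := h (Iio y) (Ici y) measurableSet_Iio measurableSet_Ici fun a ha b hb =>
    lt_of_lt_of_le ha hb
  have hIci : μ (Ici y) = 0 := by simpa [h0, hν] using hsep
  refine hμ (Measure.measure_univ_eq_zero.1 ?_)
  rw [← Iio_union_Ici (a := y)]
  exact measure_union_null h0 hIci

/-- The factor sums the bounds obtained on `Ici y` by comparison with `ν` and on `Iio y` by
comparison with `μ`. -/
theorem le_smul [IsProbabilityMeasure κ] [IsFiniteMeasure Q] (hμκ : StrictLRLe μ κ)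
    (hκν : StrictLRLe κ ν) (hμ : μ ≤ Q) (hν : ν ≤ Q) {y : α} (hμy : μ (Ici y) ≠ 0)
    (hνy : ν (Iio y) ≠ 0) : κ ≤ ((μ (Ici y))⁻¹ + (ν (Iio y))⁻¹) • Q := by
  have hfin : ∀ {ρ : Measure α}, ρ ≤ Q → ∀ A, ρ A ≠ ∞ := fun hρ A =>
    ((hρ A).trans_lt (measure_lt_top Q A)).ne
  refine Measure.le_iff.2 fun B mB => ?_
  have hbelow : μ (Ici y) * κ (B ∩ Iio y) ≤ Q B :=
    calc μ (Ici y) * κ (B ∩ Iio y) ≤ μ (B ∩ Iio y) * κ (Ici y) :=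
          hμκ _ _ (mB.inter measurableSet_Iio) measurableSet_Ici
            fun a ha b hb => lt_of_lt_of_le ha.2 hb
      _ ≤ Q B * 1 := mul_le_mul' ((hμ _).trans (measure_mono inter_subset_left)) prob_le_one
      _ = Q B := mul_one _
  have habove : ν (Iio y) * κ (B ∩ Ici y) ≤ Q B :=
    calc ν (Iio y) * κ (B ∩ Ici y) ≤ κ (Iio y) * ν (B ∩ Ici y) := by
          rw [mul_comm]
          exact hκν _ _ measurableSet_Iio (mB.inter measurableSet_Ici)
            fun a ha b hb => lt_of_lt_of_le ha hb.2
      _ ≤ 1 * Q B := mul_le_mul' prob_le_one ((hν _).trans (measure_mono inter_subset_left))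
      _ = Q B := one_mul _
  calc κ B = κ (B ∩ Iio y) + κ (B ∩ Ici y) := by
        rw [← measure_inter_add_sdiff B (measurableSet_Iio (a := y)), Set.sdiff_eq, compl_Iio]
    _ ≤ (μ (Ici y))⁻¹ * Q B + (ν (Iio y))⁻¹ * Q B := by
        gcongr
        exacts [(ENNReal.mul_le_iff_le_inv hμy (hfin hμ _)).1 hbelow,
          (ENNReal.mul_le_iff_le_inv hνy (hfin hν _)).1 habove]
    _ = (((μ (Ici y))⁻¹ + (ν (Iio y))⁻¹) • Q) B := by
        rw [Measure.smul_apply, smul_eq_mul, add_mul]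

end LinearOrder

theorem lrLe {μ ν : Measure ℝ} (h : StrictLRLe μ ν) : LRLe μ ν := by
  intro A B mA mB hAB
  rcases forall_lt_or_exists_of_forall_le hAB with hlt | ⟨c, ⟨hcA, hcB⟩, hA, hB⟩
  · exact h A B mA mB hlt
  · have hsplit (ρ : Measure ℝ) {D : Set ℝ} (hc : c ∈ D) : ρ D = ρ (D \ {c}) + ρ {c} := by
      rw [← measure_sdiff_add_inter (s := D) (measurableSet_singleton c),
        inter_singleton_of_mem hc]
    have mc : MeasurableSet ({c} : Set ℝ) := measurableSet_singleton c
    have hAB' := h _ _ (mA.diff mc) (mB.diff mc) fun a ha b hb => (hA a ha).trans (hB b hb)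
    have hAc := h _ _ (mA.diff mc) mc fun a ha b hb => mem_singleton_iff.1 hb ▸ hA a ha
    have hcB' := h _ _ mc (mB.diff mc) fun a ha b hb => mem_singleton_iff.1 ha ▸ hB b hb
    calc μ B * ν A = μ (B \ {c}) * ν (A \ {c}) + μ {c} * ν (A \ {c}) + μ (B \ {c}) * ν {c}
            + μ {c} * ν {c} := by rw [hsplit μ hcB, hsplit ν hcA]; ring
      _ ≤ μ (A \ {c}) * ν (B \ {c}) + μ (A \ {c}) * ν {c} + μ {c} * ν (B \ {c})
            + μ {c} * ν {c} := by gcongr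
      _ = μ A * ν B := by rw [hsplit μ hcA, hsplit ν hcB]; ring

end StrictLRLe

section Slice

variable {α β : Type*} [MeasurableSpace α] [MeasurableSpace β] {R : Measure (α × β)}
  {A A' : Set α} {B : Set β}

/-- The second marginal of `R` restricted to `A × β`, that is, the measure `B ↦ R (A × B)`. -/
noncomputable def slice (R : Measure (α × β)) (A : Set α) : Measure β :=
  (R.restrict (Prod.fst ⁻¹' A)).snd

theorem slice_apply (R : Measure (α × β)) (A : Set α) (hB : MeasurableSet B) :
    slice R A B = R (A ×ˢ B) := by
  rw [slice, Measure.snd_apply hB, Measure.restrict_apply (measurable_snd hB), inter_comm,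
    Set.prod_eq]

theorem slice_apply_univ (R : Measure (α × β)) (hA : MeasurableSet A) :
    slice R A univ = R.fst A := by
  rw [slice_apply R A .univ, Measure.fst_apply hA, prod_univ]

theorem slice_univ (R : Measure (α × β)) : slice R univ = R.snd := by
  rw [slice, preimage_univ, Measure.restrict_univ]

instance [IsFiniteMeasure R] : IsFiniteMeasure (slice R A) := by
  unfold slice; infer_instance

theorem slice_mono (h : A ⊆ A') : slice R A ≤ slice R A' :=
  Measure.snd_mono (Measure.restrict_mono (preimage_mono h) le_rfl)

theorem slice_le_snd (R : Measure (α × β)) (A : Set α) : slice R A ≤ R.snd :=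
  slice_univ R ▸ slice_mono (subset_univ A)

theorem slice_congr (h : A =ᵐ[R.fst] A') : slice R A = slice R A' := by
  rw [slice, slice, Measure.restrict_congr_set
    ((measurable_fst.quasiMeasurePreserving R).preimage_ae_eq h)]

theorem slice_inter_add_sdiff (R : Measure (α × β)) (A : Set α) (hA' : MeasurableSet A') :
    slice R (A ∩ A') + slice R (A \ A') = slice R A := by
  rw [slice, slice, slice, ← Measure.snd_add, preimage_inter, preimage_sdiff,
    Measure.restrict_inter_add_sdiff _ (measurable_fst hA')]

theorem setwiseTendsto_slice_iUnion (R : Measure (α × β)) {s : ℕ → Set α} (hs : Monotone s) :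
    SetwiseTendsto (fun n => slice R (s n)) atTop (slice R (⋃ n, s n)) := by
  intro B mB
  simp only [slice_apply R _ mB, iUnion_prod_const]
  exact tendsto_measure_iUnion_atTop fun m n h => prod_mono_left (hs h)

end Slice

namespace IsTP2Measure

variable {R : Measure (ℝ × ℝ)} {A A' : Set ℝ}

theorem strictLRLe_slice_of_lt (hR : IsTP2Measure R) (mA : MeasurableSet A)
    (mA' : MeasurableSet A') (h : ∀ a ∈ A, ∀ a' ∈ A', a < a') :
    StrictLRLe (slice R A) (slice R A') := by
  intro B₁ B₂ m₁ m₂ hB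
  simp only [slice_apply R _ m₁, slice_apply R _ m₂]
  rw [mul_comm]
  exact hR A A' B₁ B₂ mA mA' m₁ m₂ h hB

theorem strictLRLe_slice (hR : IsTP2Measure R) (mA : MeasurableSet A) (mA' : MeasurableSet A')
    (h : ∀ a ∈ A, ∀ a' ∈ A', a ≤ a') : StrictLRLe (slice R A) (slice R A') := by
  rcases forall_lt_or_exists_of_forall_le h with hlt | ⟨c, ⟨hcA, hcA'⟩, hA, hA'⟩
  · exact hR.strictLRLe_slice_of_lt mA mA' hlt
  · have mc : MeasurableSet ({c} : Set ℝ) := measurableSet_singleton c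
    have hAc : StrictLRLe (slice R (A \ {c})) (slice R {c}) :=
      hR.strictLRLe_slice_of_lt (mA.diff mc) mc fun a ha b hb => mem_singleton_iff.1 hb ▸ hA a ha
    have hcA'' : StrictLRLe (slice R {c}) (slice R (A' \ {c})) :=
      hR.strictLRLe_slice_of_lt mc (mA'.diff mc) fun a ha b hb =>
        mem_singleton_iff.1 ha ▸ hA' b hb
    have hAA' : StrictLRLe (slice R (A \ {c})) (slice R (A' \ {c})) :=
      hR.strictLRLe_slice_of_lt (mA.diff mc) (mA'.diff mc) fun a ha b hb =>
        (hA a ha).trans (hA' b hb)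
    rw [← slice_inter_add_sdiff R A mc, ← slice_inter_add_sdiff R A' mc,
      inter_singleton_of_mem hcA, inter_singleton_of_mem hcA']
    exact ((StrictLRLe.refl _).add_right hcA'').add_left (hAc.add_right hAA')

end IsTP2Measure

section ApproachesFromRight

theorem exists_antitone_forall_mem_exists_le {α : Type*} [ConditionallyCompleteLinearOrder α]
    [TopologicalSpace α] [OrderTopology α] [FirstCountableTopology α] {T : Set α}
    (hT : T.Nonempty) (hT' : BddBelow T) :
    ∃ t : ℕ → α, Antitone t ∧ (∀ n, t n ∈ T) ∧ ∀ x ∈ T, ∃ n, t n ≤ x := by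
  by_cases hmem : sInf T ∈ T
  · exact ⟨fun _ => sInf T, antitone_const, fun _ => hmem, fun x hx => ⟨0, csInf_le hT' hx⟩⟩
  · obtain ⟨t, hanti, htendsto, htT⟩ := exists_seq_tendsto_sInf hT hT'
    refine ⟨t, hanti, htT, fun x hx => ?_⟩
    have hlt : sInf T < x := (csInf_le hT' hx).lt_of_ne fun h => hmem (h ▸ hx)
    exact (htendsto.eventually_le_const hlt).exists

/-- The points `t n` decrease to the first point at or after `z` that is charged by `μ`. The last
condition says that `μ` does not charge the part of `Ici z` to the left of all `t n`; the sequence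
is constant if that first point is an atom. -/
structure ApproachesFromRight (μ : Measure ℝ) (z : ℝ) (t : ℕ → ℝ) : Prop where
  antitone : Antitone t
  measure_Icc_ne_zero : ∀ n, μ (Icc z (t n)) ≠ 0
  measure_sdiff_eq_zero : μ (Ici z \ ⋃ n, Ici (t n)) = 0

variable {μ : Measure ℝ} {z : ℝ} {t : ℕ → ℝ}

theorem exists_approachesFromRight (h : μ (Ici z) ≠ 0) : ∃ t, ApproachesFromRight μ z t := by
  set T : Set ℝ := {x | μ (Icc z x) ≠ 0}
  have hne : T.Nonempty := by
    by_contra hempty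
    refine h (measure_mono_null (t := ⋃ n : ℕ, Icc z n) (fun x hx => ?_)
      (measure_iUnion_null fun n => not_not.1 fun hn => hempty ⟨n, hn⟩))
    obtain ⟨n, hn⟩ := exists_nat_ge x
    exact mem_iUnion.2 ⟨n, hx, hn⟩
  have hbdd : BddBelow T := ⟨z, fun x hx => (nonempty_of_measure_ne_zero hx).elim fun _ hy =>
    hy.1.trans hy.2⟩
  obtain ⟨t, hanti, htT, hcoinitial⟩ := exists_antitone_forall_mem_exists_le hne hbdd
  refine ⟨t, hanti, htT, measure_eq_zero_of_forall_inter_Iic fun x hx => ?_⟩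
  have hxT : x ∉ T := fun hxT => hx.2 (mem_iUnion.2 (hcoinitial x hxT))
  exact measure_mono_null (t := Icc z x) (fun y hy => ⟨hy.1.1, hy.2⟩) (not_not.1 hxT)

theorem ApproachesFromRight.setwiseTendsto_slice {R : Measure (ℝ × ℝ)}
    (ht : ApproachesFromRight R.fst z t) {D : Set ℝ} (hD : D ⊆ Ici z) :
    SetwiseTendsto (fun n => slice R (D ∩ Ici (t n))) atTop (slice R D) := by
  have hae : (D ∩ ⋃ n, Ici (t n) : Set ℝ) =ᵐ[R.fst] D := by
    refine inter_subset_left.eventuallyLE.antisymm (ae_le_set.2 ?_)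
    rw [sdiff_self_inter]
    exact measure_mono_null (sdiff_subset_sdiff_left hD) ht.measure_sdiff_eq_zero
  rw [← slice_congr hae, inter_iUnion]
  exact setwiseTendsto_slice_iUnion R fun m n h =>
    inter_subset_inter_right D (Ici_subset_Ici.2 (ht.antitone h))

end ApproachesFromRight

section RightLimit

variable {R : Measure (ℝ × ℝ)} {x y z : ℝ} {L : Set ℝ} {κ κ' : Measure ℝ}

/-- `κ` lies, in the likelihood ratio order, above every slice of `R` over a set to the left of `x`
and below every slice over a set to the right. This is what singles out the conditional law at
`x` within an isotonic family. -/
structure IsBetweenSlices (R : Measure (ℝ × ℝ)) (x : ℝ) (κ : Measure ℝ) : Prop where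
  slice_le : ∀ D, MeasurableSet D → D ⊆ Iic x → StrictLRLe (slice R D) κ
  le_slice : ∀ D, MeasurableSet D → D ⊆ Ici x → StrictLRLe κ (slice R D)

theorem IsTP2Measure.strictLRLe_cond_slice_Icc (hR : IsTP2Measure R) (mL : MeasurableSet L)
    (hLz : slice R (Iic z) Lᶜ = 0) {D : Set ℝ} (mD : MeasurableSet D) (hD : D ⊆ Iic z) (r : ℝ) :
    StrictLRLe (slice R D) (slice R (Icc z r))[|L] :=
  (hR.strictLRLe_slice mD measurableSet_Icc fun _ ha _ hb => (hD ha).trans hb.1).cond_right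
    (Measure.absolutelyContinuous_of_le (slice_mono hD) hLz) mL

theorem IsTP2Measure.cond_slice_Icc_strictLRLe (hR : IsTP2Measure R) (mL : MeasurableSet L)
    (hL : IsLowerSet L) {D : Set ℝ} (mD : MeasurableSet D) {r : ℝ} (hD : D ⊆ Ici r) (z : ℝ) :
    StrictLRLe (slice R (Icc z r))[|L] (slice R D) :=
  (hR.strictLRLe_slice measurableSet_Icc mD fun _ ha _ hb => ha.2.trans (hD hb)).cond_left hL mL

/-- `κ` is a conditional law of the second coordinate given that the first one is at `z`, obtained
as a setwise limit from the right along an ultrafilter, after truncation of the second coordinate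
to `L`. The truncation makes the limit respect what is known about the slices to the left of
`z`. -/
structure IsRightLimit (R : Measure (ℝ × ℝ)) (z : ℝ) (L : Set ℝ) (κ : Measure ℝ) : Prop where
  isProbabilityMeasure : IsProbabilityMeasure κ
  exists_le_smul : ∃ C ≠ ∞, κ ≤ C • R.snd
  exists_setwiseTendsto : ∃ t, ApproachesFromRight R.fst z t ∧
    SetwiseTendsto (fun n => (slice R (Icc z (t n)))[|L]) (hyperfilter ℕ) κ

theorem IsRightLimit.compl_eq_zero (h : IsRightLimit R z L κ) (mL : MeasurableSet L) :
    κ Lᶜ = 0 := by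
  obtain ⟨t, -, htendsto⟩ := h.exists_setwiseTendsto
  exact htendsto.eq_zero mL.compl fun n => by
    rw [cond_apply mL, inter_compl_self, measure_empty, mul_zero]

theorem IsRightLimit.eq_zero (h : IsRightLimit R z L κ) {B : Set ℝ} (mB : MeasurableSet B)
    (hB : slice R (Ici z) B = 0) : κ B = 0 := by
  obtain ⟨t, -, htendsto⟩ := h.exists_setwiseTendsto
  exact htendsto.eq_zero mB fun n => cond_absolutelyContinuous
    (Measure.absolutelyContinuous_of_le (slice_mono Icc_subset_Ici_self) hB)

theorem IsRightLimit.isBetweenSlices (h : IsRightLimit R z L κ) [IsFiniteMeasure R]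
    (hR : IsTP2Measure R) (mL : MeasurableSet L) (hL : IsLowerSet L)
    (hLz : slice R (Iic z) Lᶜ = 0) : IsBetweenSlices R z κ := by
  have := h.isProbabilityMeasure
  obtain ⟨t, ht, htendsto⟩ := h.exists_setwiseTendsto
  refine ⟨fun D mD hD => .of_setwiseTendsto (.const _ _) htendsto <| .of_forall fun n =>
    hR.strictLRLe_cond_slice_Icc mL hLz mD hD (t n), fun D mD hD => ?_⟩
  have hright : ∀ m, StrictLRLe κ (slice R (D ∩ Ici (t m))) := fun m =>
    .of_setwiseTendsto htendsto (.const _ _) <| Nat.hyperfilter_le_atTop <|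
      (eventually_ge_atTop m).mono fun n hmn =>
        hR.cond_slice_Icc_strictLRLe mL hL (mD.inter measurableSet_Ici)
          (inter_subset_right.trans (Ici_subset_Ici.2 (ht.antitone hmn))) z
  exact .of_setwiseTendsto (.const κ atTop) (ht.setwiseTendsto_slice hD) (.of_forall hright)

theorem IsBetweenSlices.strictLRLe (h : IsBetweenSlices R x κ) [IsFiniteMeasure κ]
    (h' : IsRightLimit R z L κ') (hxz : x ≤ z) (mL : MeasurableSet L) (hL : κ Lᶜ = 0) :
    StrictLRLe κ κ' := by
  have := h'.isProbabilityMeasure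
  obtain ⟨t, -, htendsto⟩ := h'.exists_setwiseTendsto
  exact .of_setwiseTendsto (.const κ _) htendsto <| .of_forall fun n =>
    (h.le_slice _ measurableSet_Icc fun _ ha => hxz.trans ha.1).cond_right hL mL

theorem exists_isRightLimit [IsFiniteMeasure R] (hR : IsTP2Measure R) (mL : MeasurableSet L)
    (hL : IsLowerSet L) (hyL : Iio y ⊆ L) (hLz : slice R (Iic z) Lᶜ = 0)
    (hleft : slice R (Iic z) (Ici y) ≠ 0) (hright : slice R (Ici z) (Iio y) ≠ 0) :
    ∃ κ, IsRightLimit R z L κ := by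
  have hz : R.fst (Ici z) ≠ 0 := by
    rw [← slice_apply_univ R measurableSet_Ici]
    exact fun h => hright (measure_mono_null (subset_univ _) h)
  obtain ⟨t, ht⟩ := exists_approachesFromRight hz
  obtain ⟨m, hm⟩ : ∃ m, slice R (Ici z ∩ Ici (t m)) (Iio y) ≠ 0 :=
    ((ht.setwiseTendsto_slice subset_rfl _ measurableSet_Iio).eventually_ne hright).exists
  have hmR : ∀ n ≥ m, Ici z ∩ Ici (t m) ⊆ Ici (t n) := fun n hmn =>
    inter_subset_right.trans (Ici_subset_Ici.2 (ht.antitone hmn))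
  have mm : MeasurableSet (Ici z ∩ Ici (t m)) := measurableSet_Ici.inter measurableSet_Ici
  have hpos : ∀ n ≥ m, slice R (Icc z (t n)) L ≠ 0 := fun n hmn h => by
    have hne : slice R (Icc z (t n)) ≠ 0 := fun h0 => ht.measure_Icc_ne_zero n <| by
      rw [← slice_apply_univ R measurableSet_Icc, h0, Measure.coe_zero, Pi.zero_apply]
    exact (hR.strictLRLe_slice measurableSet_Icc mm fun _ ha _ hb =>
      ha.2.trans (hmR n hmn hb)).measure_Iio_ne_zero hne hm (measure_mono_null hyL h)
  set C := (slice R (Iic z) (Ici y))⁻¹ + (slice R (Ici z ∩ Ici (t m)) (Iio y))⁻¹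
  have hC : C ≠ ∞ :=
    ENNReal.add_ne_top.2 ⟨ENNReal.inv_ne_top.2 hleft, ENNReal.inv_ne_top.2 hm⟩
  have hprob : ∀ n ≥ m, IsProbabilityMeasure (slice R (Icc z (t n)))[|L] := fun n hmn =>
    cond_isProbabilityMeasure (hpos n hmn)
  have hle : ∀ n ≥ m, (slice R (Icc z (t n)))[|L] ≤ C • R.snd := fun n hmn =>
    have := hprob n hmn
    (hR.strictLRLe_cond_slice_Icc mL hLz measurableSet_Iic subset_rfl (t n)).le_smul
      (hR.cond_slice_Icc_strictLRLe mL hL mm (hmR n hmn) z)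
      (slice_le_snd R _) (slice_le_snd R _) hleft hm
  have := R.snd.smul_finite hC
  have hev : ∀ᶠ n in hyperfilter ℕ, m ≤ n := Nat.hyperfilter_le_atTop (eventually_ge_atTop m)
  obtain ⟨κ, hκ, htendsto⟩ := exists_setwiseTendsto (hyperfilter ℕ) (hev.mono hle)
  refine ⟨κ, ⟨tendsto_nhds_unique (htendsto univ .univ) (tendsto_const_nhds.congr' ?_)⟩,
    ⟨C, hC, hκ⟩, t, ht, htendsto⟩
  exact hev.mono fun n hmn => (hprob n hmn).measure_univ.symm

end RightLimit

section BallDensity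

section MetricSpace

variable {α : Type*} [MetricSpace α] [MeasurableSpace α] {κ Q : Measure α} {y : α}

/-- The density of `κ` with respect to `Q`, given at every point as the limit of the quotients of
the measures of shrinking balls along an ultrafilter. Unlike the Radon–Nikodym derivative, which is
determined only almost everywhere, it inherits order relations at every point. -/
noncomputable def ballDensity (κ Q : Measure α) (y : α) : ℝ≥0∞ :=
  ((Ultrafilter.of (𝓝[>] (0 : ℝ))).map fun r =>
    κ (Metric.closedBall y r) / Q (Metric.closedBall y r)).lim

theorem tendsto_ballDensity (κ Q : Measure α) (y : α) :
    Tendsto (fun r => κ (Metric.closedBall y r) / Q (Metric.closedBall y r))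
      (Ultrafilter.of (𝓝[>] (0 : ℝ))) (𝓝 (ballDensity κ Q y)) :=
  ((Ultrafilter.of (𝓝[>] (0 : ℝ))).map fun r =>
    κ (Metric.closedBall y r) / Q (Metric.closedBall y r)).le_nhds_lim

theorem ballDensity_le {C : ℝ≥0∞} (h : κ ≤ C • Q) (y : α) : ballDensity κ Q y ≤ C :=
  le_of_tendsto (tendsto_ballDensity κ Q y) <| .of_forall fun _ =>
    ENNReal.div_le_of_le_mul (h _)

theorem ballDensity_eq_zero {U : Set α} (hU : U ∈ 𝓝 y) (h : κ U = 0) :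
    ballDensity κ Q y = 0 := by
  refine tendsto_nhds_unique (tendsto_ballDensity κ Q y) (tendsto_const_nhds.congr' ?_)
  filter_upwards [Ultrafilter.of_le _ (nhdsWithin_le_nhds (eventually_closedBall_subset hU))]
    with r hr
  rw [measure_mono_null hr h, ENNReal.zero_div]

theorem eventually_closedBall_ne_zero (hy : y ∈ κ.support) :
    ∀ᶠ r in Ultrafilter.of (𝓝[>] (0 : ℝ)), κ (Metric.closedBall y r) ≠ 0 := by
  filter_upwards [Ultrafilter.of_le _ self_mem_nhdsWithin] with r hr
  exact ((Measure.mem_support_iff_forall y).1 hy _ (Metric.closedBall_mem_nhds y hr)).ne'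

theorem ballDensity_ae_eq_rnDeriv [SecondCountableTopology α] [BorelSpace α]
    [HasBesicovitchCovering α] [IsLocallyFiniteMeasure κ] [IsLocallyFiniteMeasure Q] :
    ballDensity κ Q =ᵐ[Q] κ.rnDeriv Q := by
  filter_upwards [Besicovitch.ae_tendsto_rnDeriv κ Q] with y hy
  exact tendsto_nhds_unique (tendsto_ballDensity κ Q y) (hy.mono_left (Ultrafilter.of_le _))

end MetricSpace

variable {κ κ₁ κ₂ Q Q₁ Q₂ : Measure ℝ} {y₁ y₂ : ℝ}

theorem eventually_closedBall_lt (h : y₁ < y₂) :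
    ∀ᶠ r in 𝓝 (0 : ℝ), ∀ a ∈ Metric.closedBall y₁ r, ∀ b ∈ Metric.closedBall y₂ r, a < b := by
  obtain ⟨m, hm₁, hm₂⟩ := exists_between h
  filter_upwards [eventually_closedBall_subset (Iio_mem_nhds hm₁),
    eventually_closedBall_subset (Ioi_mem_nhds hm₂)] with r h₁ h₂ a ha b hb
  exact (h₁ ha).trans (h₂ hb)

theorem StrictLRLe.eventually_div_mul_div_le (h : StrictLRLe κ₁ κ₂) (Q : Measure ℝ)
    (hy : y₁ < y₂) : ∀ᶠ r in Ultrafilter.of (𝓝[>] (0 : ℝ)),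
      κ₂ (Metric.closedBall y₁ r) / Q (Metric.closedBall y₁ r) *
          (κ₁ (Metric.closedBall y₂ r) / Q (Metric.closedBall y₂ r)) ≤
        κ₁ (Metric.closedBall y₁ r) / Q (Metric.closedBall y₁ r) *
          (κ₂ (Metric.closedBall y₂ r) / Q (Metric.closedBall y₂ r)) := by
  filter_upwards [Ultrafilter.of_le _ (nhdsWithin_le_nhds (eventually_closedBall_lt hy))] with r hr
  have hsep := h _ _ measurableSet_closedBall measurableSet_closedBall hr
  simp only [div_eq_mul_inv, mul_mul_mul_comm _ (_⁻¹)]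
  exact mul_le_mul_left ((mul_comm _ _).trans_le hsep) _

theorem StrictLRLe.ballDensity_mul_le (h : StrictLRLe κ₁ κ₂)
    (h₁ : ∀ y, ballDensity κ₁ Q y ≠ ∞) (h₂ : ∀ y, ballDensity κ₂ Q y ≠ ∞) (hy : y₁ < y₂) :
    ballDensity κ₂ Q y₁ * ballDensity κ₁ Q y₂ ≤ ballDensity κ₁ Q y₁ * ballDensity κ₂ Q y₂ :=
  have tends := fun κ y => tendsto_ballDensity κ Q y
  le_of_tendsto_of_tendsto
    (ENNReal.Tendsto.mul (tends κ₂ y₁) (.inr (h₁ _)) (tends κ₁ y₂) (.inr (h₂ _)))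
    (ENNReal.Tendsto.mul (tends κ₁ y₁) (.inr (h₂ _)) (tends κ₂ y₂) (.inr (h₁ _)))
    (h.eventually_div_mul_div_le Q hy)

theorem StrictLRLe.antitoneOn_ballDensity [IsFiniteMeasure κ] (h : StrictLRLe Q κ) :
    AntitoneOn (ballDensity Q κ) κ.support := by
  intro y₁ hy₁ y₂ hy₂ hy
  rcases hy.eq_or_lt with rfl | hy
  · exact le_rfl
  refine le_of_tendsto_of_tendsto (tendsto_ballDensity _ _ _) (tendsto_ballDensity _ _ _) ?_
  filter_upwards [h.eventually_div_mul_div_le κ hy, eventually_closedBall_ne_zero hy₁,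
    eventually_closedBall_ne_zero hy₂] with r hr h₁ h₂
  simpa only [ENNReal.div_self h₁ (measure_ne_top _ _), ENNReal.div_self h₂ (measure_ne_top _ _),
    one_mul, mul_one] using hr

theorem StrictLRLe.monotoneOn_ballDensity [IsFiniteMeasure κ] (h : StrictLRLe κ Q) :
    MonotoneOn (ballDensity Q κ) κ.support := by
  intro y₁ hy₁ y₂ hy₂ hy
  rcases hy.eq_or_lt with rfl | hy
  · exact le_rfl
  refine le_of_tendsto_of_tendsto (tendsto_ballDensity _ _ _) (tendsto_ballDensity _ _ _) ?_
  filter_upwards [h.eventually_div_mul_div_le κ hy, eventually_closedBall_ne_zero hy₁,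
    eventually_closedBall_ne_zero hy₂] with r hr h₁ h₂
  simpa only [ENNReal.div_self h₁ (measure_ne_top _ _), ENNReal.div_self h₂ (measure_ne_top _ _),
    one_mul, mul_one] using hr

theorem inv_ballDensity_add [IsFiniteMeasure κ] {y : ℝ} (hy : y ∈ κ.support) :
    (ballDensity Q₁ κ y + ballDensity Q₂ κ y)⁻¹ = ballDensity κ (Q₁ + Q₂) y := by
  refine tendsto_nhds_unique ?_ (tendsto_ballDensity κ (Q₁ + Q₂) y)
  refine ((tendsto_ballDensity Q₁ κ y).add (tendsto_ballDensity Q₂ κ y)).inv.congr' ?_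
  filter_upwards [eventually_closedBall_ne_zero hy] with r hr
  rw [← ENNReal.add_div, ENNReal.inv_div (.inl (measure_ne_top _ _)) (.inl hr), Measure.add_apply]

theorem StrictLRLe.measurable_ballDensity [IsFiniteMeasure κ] (h₁ : StrictLRLe Q₁ κ)
    (h₂ : StrictLRLe κ Q₂) : Measurable (ballDensity κ (Q₁ + Q₂)) := by
  obtain ⟨g₁, hg₁, heq₁⟩ := h₁.antitoneOn_ballDensity.exists_antitone_extension
    (OrderBot.bddBelow _) (OrderTop.bddAbove _)
  obtain ⟨g₂, hg₂, heq₂⟩ := h₂.monotoneOn_ballDensity.exists_monotone_extension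
    (OrderBot.bddBelow _) (OrderTop.bddAbove _)
  have hindicator : ballDensity κ (Q₁ + Q₂) = κ.support.indicator fun y => (g₁ y + g₂ y)⁻¹ := by
    ext y
    by_cases hy : y ∈ κ.support
    · rw [indicator_of_mem hy, ← heq₁ hy, ← heq₂ hy, inv_ballDensity_add hy]
    · obtain ⟨U, hU, hκU⟩ := Measure.notMem_support_iff_exists.1 hy
      rw [indicator_of_notMem hy, ballDensity_eq_zero hU hκU]
  rw [hindicator]
  exact (hg₁.measurable.add hg₂.measurable).inv.indicator Measure.isClosed_support.measurableSet

theorem isBoundedDensity_ballDensity [IsFiniteMeasure κ] [IsFiniteMeasure Q] {C : ℝ≥0∞}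
    (hC : C ≠ ∞) (h : κ ≤ C • Q) (hm : Measurable (ballDensity κ Q)) :
    IsBoundedDensity (fun y => (ballDensity κ Q y).toReal) κ Q := by
  refine ⟨hm.ennreal_toReal, fun _ => ENNReal.toReal_nonneg,
    ⟨C.toReal, fun y => ENNReal.toReal_mono hC (ballDensity_le h y)⟩, ?_⟩
  have hfinite : ∀ y, ballDensity κ Q y ≠ ∞ := fun y =>
    ((ballDensity_le h y).trans_lt hC.lt_top).ne
  have hac : κ ≪ Q := Measure.absolutelyContinuous_of_le_smul h
  simp only [ENNReal.ofReal_toReal (hfinite _)]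
  rw [withDensity_congr_ae ballDensity_ae_eq_rnDeriv, Measure.withDensity_rnDeriv_eq _ _ hac]

end BallDensity

section Disintegration

theorem measurable_of_strictLRLe {K : ℝ → Measure ℝ} [∀ x, IsProbabilityMeasure (K x)]
    {I : Set ℝ} (hI : I.OrdConnected) {ρ : Measure ℝ} (hρ : ∀ x ∉ I, K x = ρ)
    (hK : ∀ x₁ ∈ I, ∀ x₂ ∈ I, x₁ < x₂ → StrictLRLe (K x₁) (K x₂)) : Measurable K := by
  refine Measurable.measure_of_isPiSystem_of_isProbabilityMeasure
    (borel_eq_generateFrom_Iic ℝ ▸ BorelSpace.measurable_eq) isPiSystem_Iic ?_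
  rintro _ ⟨c, rfl⟩
  have hanti : AntitoneOn (fun x => K x (Iic c)) I := fun a ha b hb hab => by
    rcases hab.eq_or_lt with rfl | hlt
    · exact le_rfl
    · simpa only [measure_univ, mul_one] using (hK a ha b hb hlt).measure_Iic_mul_le c
  refine measurable_of_restrict_of_restrict_compl hI.measurableSet ?_ ?_
  · exact Antitone.measurable fun a b hab => hanti a.2 b.2 hab
  · have hconst : Iᶜ.domRestrict (fun x => K x (Iic c)) = fun _ => ρ (Iic c) :=
      funext fun x => congrArg (· (Iic c)) (hρ x x.2)
    exact hconst ▸ measurable_const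

theorem slice_apply_eq_setLIntegral_condKernel (R : Measure (ℝ × ℝ)) [IsFiniteMeasure R]
    {A B : Set ℝ} (hA : MeasurableSet A) (hB : MeasurableSet B) :
    slice R A B = ∫⁻ x in A, R.condKernel x B ∂(R.fst) := by
  rw [slice_apply R A hB, ← Measure.compProd_apply_prod hA hB, R.disintegrate R.condKernel]

variable {R : Measure (ℝ × ℝ)} [IsFiniteMeasure R] {x : ℝ} {κ : Measure ℝ}
  [IsProbabilityMeasure κ]

theorem IsBetweenSlices.ae_condKernel_le (h : IsBetweenSlices R x κ) (c : ℝ) :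
    ∀ᵐ y ∂(R.fst), x ≤ y → R.condKernel y (Iic c) ≤ κ (Iic c) := by
  refine (ae_restrict_iff' measurableSet_Ici).1
    (ae_le_of_forall_setLIntegral_le_of_sigmaFinite
      (R.condKernel.measurable_coe measurableSet_Iic) fun D mD _ => ?_)
  have hle := (h.le_slice _ (mD.inter measurableSet_Ici) inter_subset_right).measure_Iic_mul_le c
  rwa [measure_univ, mul_one, slice_apply_univ R (mD.inter measurableSet_Ici),
    slice_apply_eq_setLIntegral_condKernel R (mD.inter measurableSet_Ici) measurableSet_Iic,
    ← setLIntegral_const, ← Measure.restrict_restrict mD] at hle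

theorem IsBetweenSlices.ae_le_condKernel (h : IsBetweenSlices R x κ) (c : ℝ) :
    ∀ᵐ y ∂(R.fst), y ≤ x → κ (Iic c) ≤ R.condKernel y (Iic c) := by
  refine (ae_restrict_iff' measurableSet_Iic).1
    (ae_le_of_forall_setLIntegral_le_of_sigmaFinite measurable_const fun D mD _ => ?_)
  have hle := (h.slice_le _ (mD.inter measurableSet_Iic) inter_subset_right).measure_Iic_mul_le c
  rwa [measure_univ (μ := κ), mul_one, slice_apply_univ R (mD.inter measurableSet_Iic),
    slice_apply_eq_setLIntegral_condKernel R (mD.inter measurableSet_Iic) measurableSet_Iic,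
    ← setLIntegral_const, ← Measure.restrict_restrict mD] at hle

theorem fst_compProd_eq_of_isBetweenSlices {K : Kernel ℝ ℝ} [IsMarkovKernel K]
    (hK : ∀ᵐ x ∂(R.fst), IsBetweenSlices R x (K x)) : R.fst ⊗ₘ K = R := by
  have hae : ∀ c, (fun x => R.condKernel x (Iic c)) =ᵐ[R.fst] fun x => K x (Iic c) := fun c =>
    (ae_le_of_ae_forall_ge (hK.mono fun x hx => hx.ae_condKernel_le c)).antisymm
      (ae_le_of_ae_forall_le (hK.mono fun x hx => hx.ae_le_condKernel c))
  refine Measure.ext_prod fun {A B} hA hB => ?_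
  rw [← slice_apply _ A hB, ← slice_apply _ A hB]
  congr 1
  refine Measure.ext_of_Iic _ _ fun c => ?_
  rw [slice_apply_eq_setLIntegral_condKernel R hA measurableSet_Iic,
    slice_apply _ A measurableSet_Iic, Measure.compProd_apply_prod hA measurableSet_Iic]
  exact (setLIntegral_congr_fun_ae hA ((hae c).mono fun x hx _ => hx)).symm

end Disintegration

section Boundaries

variable {Ω : Type*} [MeasurableSpace Ω] {P : Measure Ω} {X Y : Ω → ℝ} {x : ℝ}

/-- The joint distribution of `X` and `Y`. -/
noncomputable abbrev jointLaw (P : Measure Ω) (X Y : Ω → ℝ) : Measure (ℝ × ℝ) :=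
  P.map fun ω => (X ω, Y ω)

theorem slice_jointLaw_apply (hX : Measurable X) (hY : Measurable Y) {A B : Set ℝ}
    (hA : MeasurableSet A) (hB : MeasurableSet B) :
    slice (jointLaw P X Y) A B = P {ω | X ω ∈ A ∧ Y ω ∈ B} := by
  rw [slice_apply _ A hB, Measure.map_apply (hX.prodMk hY) (hA.prod hB)]
  rfl

theorem measurableSet_coe_le (s : EReal) : MeasurableSet {y : ℝ | (y : EReal) ≤ s} :=
  measurable_coe_real_ereal measurableSet_Iic

theorem measurableSet_coe_lt (s : EReal) : MeasurableSet {y : ℝ | (y : EReal) < s} :=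
  measurable_coe_real_ereal measurableSet_Iio

theorem isLowerSet_coe_le (s : EReal) : IsLowerSet {y : ℝ | (y : EReal) ≤ s} :=
  (isLowerSet_Iic s).preimage EReal.coe_strictMono.monotone

theorem slice_Iic_Snw (hX : Measurable X) (hY : Measurable Y) (x : ℝ) :
    slice (jointLaw P X Y) (Iic x) {y : ℝ | (y : EReal) ≤ Snw P X Y x}ᶜ = 0 := by
  rw [slice_jointLaw_apply hX hY measurableSet_Iic (measurableSet_coe_le _).compl]
  simpa only [mem_Iic, mem_compl_iff, mem_ofPred_eq, not_le] using (isLeast_Snw P X Y x).1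

theorem slice_Ici_Sse (hX : Measurable X) (hY : Measurable Y) (x : ℝ) :
    slice (jointLaw P X Y) (Ici x) {y : ℝ | (y : EReal) < Sse P X Y x} = 0 := by
  rw [slice_jointLaw_apply hX hY measurableSet_Ici (measurableSet_coe_lt _)]
  exact (isGreatest_Sse P X Y x).1

theorem slice_Iic_ne_zero (hX : Measurable X) (hY : Measurable Y) {y : ℝ}
    (hy : y < Snw P X Y x) : slice (jointLaw P X Y) (Iic x) (Ici y) ≠ 0 := by
  rw [slice_jointLaw_apply hX hY measurableSet_Iic measurableSet_Ici]
  refine fun h => hy.not_ge ((isLeast_Snw P X Y x).2 (measure_mono_null ?_ h))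
  exact fun ω hω => ⟨hω.1, (EReal.coe_lt_coe_iff.1 hω.2).le⟩

theorem slice_Ici_ne_zero (hX : Measurable X) (hY : Measurable Y) {y : ℝ}
    (hy : Sse P X Y x < y) : slice (jointLaw P X Y) (Ici x) (Iio y) ≠ 0 := by
  rw [slice_jointLaw_apply hX hY measurableSet_Ici measurableSet_Iio]
  refine fun h => hy.not_ge ((isGreatest_Sse P X Y x).2 (measure_mono_null ?_ h))
  exact fun ω hω => ⟨hω.1, EReal.coe_lt_coe_iff.1 hω.2⟩

theorem Snw_mono (P : Measure Ω) (X Y : Ω → ℝ) : Monotone (Snw P X Y) := fun x₁ x₂ h =>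
  (isLeast_Snw P X Y x₁).2 <|
    measure_mono_null (t := {ω | X ω ≤ x₂ ∧ Snw P X Y x₂ < Y ω})
      (fun _ hω => ⟨hω.1.trans h, hω.2⟩) (isLeast_Snw P X Y x₂).1

theorem Sse_mono (P : Measure Ω) (X Y : Ω → ℝ) : Monotone (Sse P X Y) := fun x₁ x₂ h =>
  (isGreatest_Sse P X Y x₂).2 <|
    measure_mono_null (t := {ω | x₁ ≤ X ω ∧ Y ω < Sse P X Y x₁})
      (fun _ hω => ⟨h.trans hω.1, hω.2⟩) (isGreatest_Sse P X Y x₁).1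

theorem Snw_ne_bot (hx : x ∈ range P X) : Snw P X Y x ≠ ⊥ := by
  intro h
  have hleast := h ▸ (isLeast_Snw P X Y x).1
  simp only [mem_ofPred_eq, EReal.bot_lt_coe, and_true] at hleast
  exact hx.1.ne' hleast

theorem Sse_ne_top (hx : x ∈ range P X) : Sse P X Y x ≠ ⊤ := by
  intro h
  have hgreatest := h ▸ (isGreatest_Sse P X Y x).1
  simp only [mem_ofPred_eq, EReal.coe_lt_top, and_true] at hgreatest
  exact hx.2.ne' hgreatest

theorem Sse_lt_Snw (hx : x ∈ range P X \ rangeO P X Y) : Sse P X Y x < Snw P X Y x :=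
  not_le.1 fun h => hx.2 ⟨hx.1, h⟩

theorem exists_isIsotonicSelection (P : Measure Ω) (X Y : Ω → ℝ) :
    ∃ S : ℝ → ℝ, IsIsotonicSelection P X Y S := by
  have hcoe : ∀ x ∈ rangeO P X Y, ((Snw P X Y x).toReal : EReal) = Snw P X Y x := fun x hx =>
    EReal.coe_toReal (fun h => Sse_ne_top hx.1 (top_le_iff.1 (h ▸ hx.2))) (Snw_ne_bot hx.1)
  refine ⟨fun x => (Snw P X Y x).toReal, fun x₁ h₁ x₂ h₂ hle => ?_, fun x hx => ?_⟩
  · rw [← EReal.coe_le_coe_iff, hcoe x₁ h₁, hcoe x₂ h₂]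
    exact Snw_mono P X Y hle
  · rw [hcoe x hx]
    exact ⟨le_rfl, hx.2⟩

theorem ordConnected_range (P : Measure Ω) (X : Ω → ℝ) : (range P X).OrdConnected :=
  ⟨fun _ ha _ hb _ hx => ⟨ha.1.trans_le (measure_mono fun _ hω => le_trans hω hx.1),
    hb.2.trans_le (measure_mono fun _ hω => le_trans hx.2 hω)⟩⟩

theorem ae_mem_range (hX : Measurable X) : ∀ᵐ x ∂P.map X, x ∈ range P X := by
  have hleft : P.map X {x | P {ω | X ω ≤ x} = 0} = 0 :=
    measure_eq_zero_of_forall_inter_Iic fun x hx => measure_mono_null inter_subset_right <| by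
      rw [Measure.map_apply hX measurableSet_Iic]; exact hx
  have hright : P.map X {x | P {ω | x ≤ X ω} = 0} = 0 :=
    measure_eq_zero_of_forall_inter_Ici fun x hx => measure_mono_null inter_subset_right <| by
      rw [Measure.map_apply hX measurableSet_Ici]; exact hx
  filter_upwards [measure_eq_zero_iff_ae_notMem.1 hleft, measure_eq_zero_iff_ae_notMem.1 hright]
    with x h₁ h₂
  exact ⟨pos_iff_ne_zero.2 h₁, pos_iff_ne_zero.2 h₂⟩

theorem exists_isRightLimit_of_mem [IsFiniteMeasure P] (hX : Measurable X) (hY : Measurable Y)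
    (hTP2 : IsTP2Measure (jointLaw P X Y)) (hx : x ∈ range P X \ rangeO P X Y) :
    ∃ κ, IsRightLimit (jointLaw P X Y) x {y : ℝ | (y : EReal) ≤ Snw P X Y x} κ := by
  obtain ⟨y, hySse, hySnw⟩ := EReal.lt_iff_exists_real_btwn.1 (Sse_lt_Snw hx)
  exact exists_isRightLimit hTP2 (measurableSet_coe_le _) (isLowerSet_coe_le _)
    (fun t ht => (EReal.coe_lt_coe_iff.2 ht).le.trans hySnw.le) (slice_Iic_Snw hX hY x)
    (slice_Iic_ne_zero hX hY hySnw) (slice_Ici_ne_zero hX hY hySse)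

theorem IsIsotonicSelection.isBetweenSlices_dirac {S : ℝ → ℝ} (hS : IsIsotonicSelection P X Y S)
    (hX : Measurable X) (hY : Measurable Y) (hx : x ∈ rangeO P X Y) :
    IsBetweenSlices (jointLaw P X Y) x (Measure.dirac (S x)) where
  slice_le D _ hD := by
    refine .of_separated (s := S x)
      (Measure.absolutelyContinuous_of_le (slice_mono hD) (measure_mono_null (fun y hy => ?_)
        (slice_Iic_Snw hX hY x))) (by simp)
    exact not_le.2 ((hS.2 x hx).1.trans_lt (EReal.coe_lt_coe_iff.2 hy))
  le_slice D _ hD := by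
    refine .of_separated (s := S x) (by simp)
      (Measure.absolutelyContinuous_of_le (slice_mono hD) (measure_mono_null (fun y hy => ?_)
        (slice_Ici_Sse hX hY x)))
    exact (EReal.coe_lt_coe_iff.2 hy).trans_le (hS.2 x hx).2

end Boundaries

section Family

variable {Ω : Type*} [MeasurableSpace Ω] {P : Measure Ω} {X Y : Ω → ℝ} {S : ℝ → ℝ}
  {K : ℝ → Measure ℝ} {x : ℝ}

/-- `K` is a pointwise choice of conditional laws of `Y` given `X`: the point mass at `S x` for `x`
in `rangeO`, and a limit from the right at the other points of the range. Its value outside the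
range is arbitrary; it is kept constant there so that `K` is measurable. -/
structure IsConditionalFamily (P : Measure Ω) (X Y : Ω → ℝ) (S : ℝ → ℝ) (K : ℝ → Measure ℝ) :
    Prop where
  eq_dirac : ∀ x ∈ rangeO P X Y, K x = Measure.dirac (S x)
  isRightLimit : ∀ x ∈ range P X \ rangeO P X Y,
    IsRightLimit (jointLaw P X Y) x {y : ℝ | (y : EReal) ≤ Snw P X Y x} (K x)
  eq_of_notMem : ∀ x ∉ range P X, K x = Measure.dirac 0

theorem exists_isConditionalFamily [IsFiniteMeasure P] (hX : Measurable X) (hY : Measurable Y)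
    (hTP2 : IsTP2Measure (jointLaw P X Y)) (S : ℝ → ℝ) :
    ∃ K, IsConditionalFamily P X Y S K := by
  classical
  choose! κ hκ using fun x hx => exists_isRightLimit_of_mem hX hY hTP2 (x := x) hx
  refine ⟨fun x => if x ∈ rangeO P X Y then Measure.dirac (S x)
    else if x ∈ range P X then κ x else Measure.dirac 0, fun x hx => if_pos hx,
    fun x hx => ?_, fun x hx => ?_⟩
  · simpa only [if_neg hx.2, if_pos hx.1] using hκ x hx
  · simp only [if_neg hx, if_neg fun h : x ∈ rangeO P X Y => hx h.1]

namespace IsConditionalFamily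

theorem isProbabilityMeasure (hK : IsConditionalFamily P X Y S K) (x : ℝ) :
    IsProbabilityMeasure (K x) := by
  by_cases hx : x ∈ range P X
  · by_cases hxo : x ∈ rangeO P X Y
    · rw [hK.eq_dirac x hxo]; infer_instance
    · exact (hK.isRightLimit x ⟨hx, hxo⟩).isProbabilityMeasure
  · rw [hK.eq_of_notMem x hx]; infer_instance

theorem measure_Ioi_eq_zero (hK : IsConditionalFamily P X Y S K)
    (hS : IsIsotonicSelection P X Y S) {x₁ x₂ : ℝ} (h₁ : x₁ ∈ range P X)
    (h₂ : x₂ ∈ rangeO P X Y) (h : x₁ ≤ x₂) : K x₁ (Ioi (S x₂)) = 0 := by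
  by_cases ho : x₁ ∈ rangeO P X Y
  · simpa [hK.eq_dirac x₁ ho] using hS.1 ho h₂ h
  · refine measure_mono_null (fun y hy => ?_)
      ((hK.isRightLimit x₁ ⟨h₁, ho⟩).compl_eq_zero (measurableSet_coe_le _))
    exact not_le.2 (((Snw_mono P X Y h).trans (hS.2 x₂ h₂).1).trans_lt (EReal.coe_lt_coe_iff.2 hy))

theorem measure_compl_Snw_eq_zero (hK : IsConditionalFamily P X Y S K)
    (hS : IsIsotonicSelection P X Y S) {x₁ x₂ : ℝ} (h₁ : x₁ ∈ range P X)
    (h₂ : x₂ ∈ range P X \ rangeO P X Y) (h : x₁ ≤ x₂) :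
    K x₁ {y : ℝ | (y : EReal) ≤ Snw P X Y x₂}ᶜ = 0 := by
  by_cases ho : x₁ ∈ rangeO P X Y
  · have hle : (S x₁ : EReal) ≤ Snw P X Y x₂ :=
      (hS.2 x₁ ho).2.trans ((Sse_mono P X Y h).trans (Sse_lt_Snw h₂).le)
    rw [hK.eq_dirac x₁ ho, Measure.dirac_apply' _ (measurableSet_coe_le _).compl]
    exact indicator_of_notMem (not_not.2 hle) _
  · exact measure_mono_null (compl_subset_compl.2 fun y hy => le_trans hy (Snw_mono P X Y h))
      ((hK.isRightLimit x₁ ⟨h₁, ho⟩).compl_eq_zero (measurableSet_coe_le _))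

theorem ballDensity_ne_top (hK : IsConditionalFamily P X Y S K)
    (hX : Measurable X) (hx : x ∈ range P X \ rangeO P X Y) (y : ℝ) :
    ballDensity (K x) (P.map Y) y ≠ ∞ := by
  have hsnd : (jointLaw P X Y).snd = P.map Y := Measure.snd_map_prodMk hX
  obtain ⟨C, hC, hle⟩ := (hK.isRightLimit x hx).exists_le_smul
  exact ((ballDensity_le (hsnd ▸ hle) y).trans_lt hC.lt_top).ne

theorem ballDensity_eq_zero (hK : IsConditionalFamily P X Y S K)
    (hX : Measurable X) (hY : Measurable Y) (Q : Measure ℝ)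
    (hx : x ∈ range P X \ rangeO P X Y) {y : ℝ}
    (hy : (y : EReal) < Sse P X Y x ∨ Snw P X Y x < (y : EReal)) :
    ballDensity (K x) Q y = 0 := by
  have hlim := hK.isRightLimit x hx
  rcases hy with hy | hy
  · exact LikelihoodRatio.ballDensity_eq_zero
      ((isOpen_Iio.preimage continuous_coe_real_ereal).mem_nhds hy)
      (hlim.eq_zero (measurableSet_coe_lt _) (slice_Ici_Sse hX hY x))
  · exact LikelihoodRatio.ballDensity_eq_zero
      ((isClosed_Iic.preimage continuous_coe_real_ereal).isOpen_compl.mem_nhds (not_le.2 hy))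
      (hlim.compl_eq_zero (measurableSet_coe_le _))

section

variable [IsFiniteMeasure P] (hK : IsConditionalFamily P X Y S K) (hX : Measurable X)
  (hY : Measurable Y) (hTP2 : IsTP2Measure (jointLaw P X Y)) (hS : IsIsotonicSelection P X Y S)
include hK hX hY hTP2 hS

theorem isBetweenSlices (hx : x ∈ range P X) : IsBetweenSlices (jointLaw P X Y) x (K x) := by
  by_cases hxo : x ∈ rangeO P X Y
  · rw [hK.eq_dirac x hxo]
    exact hS.isBetweenSlices_dirac hX hY hxo
  · exact (hK.isRightLimit x ⟨hx, hxo⟩).isBetweenSlices hTP2 (measurableSet_coe_le _)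
      (isLowerSet_coe_le _) (slice_Iic_Snw hX hY x)

theorem strictLRLe {x₁ x₂ : ℝ} (h₁ : x₁ ∈ range P X) (h₂ : x₂ ∈ range P X) (h : x₁ ≤ x₂) :
    StrictLRLe (K x₁) (K x₂) := by
  have := hK.isProbabilityMeasure x₁
  by_cases ho : x₂ ∈ rangeO P X Y
  · refine .of_separated (hK.measure_Ioi_eq_zero hS h₁ ho h) ?_
    simp [hK.eq_dirac x₂ ho]
  · exact (hK.isBetweenSlices hX hY hTP2 hS h₁).strictLRLe (hK.isRightLimit x₂ ⟨h₂, ho⟩) h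
      (measurableSet_coe_le _) (hK.measure_compl_Snw_eq_zero hS h₁ ⟨h₂, ho⟩ h)

theorem measurable : Measurable K :=
  have := hK.isProbabilityMeasure
  measurable_of_strictLRLe (ordConnected_range P X) hK.eq_of_notMem fun _ h₁ _ h₂ h =>
    hK.strictLRLe hX hY hTP2 hS h₁ h₂ h.le

theorem isBoundedDensity_ballDensity (hx : x ∈ range P X \ rangeO P X Y) :
    IsBoundedDensity (fun y => (ballDensity (K x) (P.map Y) y).toReal) (K x) (P.map Y) := by
  have := hK.isProbabilityMeasure x
  have hsnd : (jointLaw P X Y).snd = P.map Y := Measure.snd_map_prodMk hX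
  obtain ⟨C, hC, hle⟩ := (hK.isRightLimit x hx).exists_le_smul
  rw [← hsnd]
  refine LikelihoodRatio.isBoundedDensity_ballDensity hC hle ?_
  have hbetween := hK.isBetweenSlices hX hY hTP2 hS hx.1
  rw [← slice_univ, ← slice_inter_add_sdiff _ univ measurableSet_Iio, univ_inter,
    ← compl_eq_univ_sdiff, compl_Iio]
  exact (hbetween.slice_le _ measurableSet_Iio Iio_subset_Iic_self).measurable_ballDensity
    (hbetween.le_slice _ measurableSet_Ici subset_rfl)

theorem isTP2On_ballDensity :
    IsTP2On (fun x y => (ballDensity (K x) (P.map Y) y).toReal) (range P X \ rangeO P X Y) := by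
  intro x₁ h₁ x₂ h₂ h y₁ y₂ hy
  have hfinite := fun x hx => hK.ballDensity_ne_top hX (x := x) hx
  rw [← ENNReal.toReal_mul, ← ENNReal.toReal_mul]
  exact ENNReal.toReal_mono (ENNReal.mul_ne_top (hfinite x₁ h₁ _) (hfinite x₂ h₂ _))
    ((hK.strictLRLe hX hY hTP2 hS h₁.1 h₂.1 h.le).ballDensity_mul_le
      (hfinite x₁ h₁) (hfinite x₂ h₂) hy)

end

theorem hasCondDistrib [IsFiniteMeasure P] {K : Kernel ℝ ℝ} [IsMarkovKernel K]
    (hK : IsConditionalFamily P X Y S K) (hX : Measurable X) (hY : Measurable Y)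
    (hTP2 : IsTP2Measure (jointLaw P X Y)) (hS : IsIsotonicSelection P X Y S) :
    HasCondDistrib Y X K P := by
  refine ⟨(hX.prodMk hY).aemeasurable, ?_⟩
  have hfst : (jointLaw P X Y).fst = P.map X := Measure.fst_map_prodMk hY
  rw [← hfst]
  refine (fst_compProd_eq_of_isBetweenSlices ?_).symm
  rw [hfst]
  exact (ae_mem_range hX).mono fun x hx => hK.isBetweenSlices hX hY hTP2 hS hx

end IsConditionalFamily

end Family

end LikelihoodRatio

open LikelihoodRatio in
theorem theorem3 {Ω : Type*} [MeasurableSpace Ω] (P : Measure Ω) [IsProbabilityMeasure P]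
    (X Y : Ω → ℝ) (hX : Measurable X) (hY : Measurable Y)
    (hTP2 : LikelihoodRatio.IsTP2Measure (P.map fun ω => (X ω, Y ω))) :
    (∃ S : ℝ → ℝ, LikelihoodRatio.IsIsotonicSelection P X Y S) ∧
    ∀ S : ℝ → ℝ, LikelihoodRatio.IsIsotonicSelection P X Y S →
      ∃ K : Kernel ℝ ℝ, IsMarkovKernel K ∧ HasCondDistrib Y X K P ∧
        (∀ x₁ ∈ LikelihoodRatio.range P X, ∀ x₂ ∈ LikelihoodRatio.range P X, x₁ < x₂ →
          LikelihoodRatio.LRLe (K x₁) (K x₂)) ∧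
        (∀ x ∈ LikelihoodRatio.rangeO P X Y, K x = Measure.dirac (S x)) ∧
        ∃ h : ℝ → ℝ → ℝ,
          (∀ x ∈ LikelihoodRatio.range P X \ LikelihoodRatio.rangeO P X Y,
            LikelihoodRatio.IsBoundedDensity (h x) (K x) (P.map Y) ∧
            ∀ y : ℝ, ((y : EReal) < LikelihoodRatio.Sse P X Y x ∨
              LikelihoodRatio.Snw P X Y x < (y : EReal)) → h x y = 0) ∧
          LikelihoodRatio.IsTP2On h
            (LikelihoodRatio.range P X \ LikelihoodRatio.rangeO P X Y) := by
  refine ⟨exists_isIsotonicSelection P X Y, fun S hS => ?_⟩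
  obtain ⟨K₀, hK⟩ := exists_isConditionalFamily hX hY hTP2 S
  let K : Kernel ℝ ℝ := ⟨K₀, hK.measurable hX hY hTP2 hS⟩
  have hKprob : IsMarkovKernel K := ⟨hK.isProbabilityMeasure⟩
  refine ⟨K, hKprob, IsConditionalFamily.hasCondDistrib (K := K) hK hX hY hTP2 hS,
    fun x₁ h₁ x₂ h₂ h => (hK.strictLRLe hX hY hTP2 hS h₁ h₂ h.le).lrLe, hK.eq_dirac,
    fun x y => (ballDensity (K x) (P.map Y) y).toReal, fun x hx => ⟨?_, fun y hy => ?_⟩,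
    hK.isTP2On_ballDensity hX hY hTP2 hS⟩
  · exact hK.isBoundedDensity_ballDensity hX hY hTP2 hS hx
  · exact congrArg ENNReal.toReal (hK.ballDensity_eq_zero hX hY _ hx hy)
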